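/- Let $\mathbf K$ be a field that is complete with respect to a non-trivial non-Archimedean absolute value $|\cdot|$ with values in $[0,\infty)$ (for example, a non-discrete locally compact non-Archimedean field). Let $X$ be either the countable product $\mathbf s=\mathbf K^{\omega_0}$ with the Tychonoff topology, or the Banach space $c_0=c_0(\omega_0,\mathbf K)$ of all sequences $x=(x_j)$ in $\mathbf K$ with $x_j\to 0$, with the norm $\|x\|=\sup_j|x_j|$. Let $\pi_j:X\to\mathbf K$, $\pi_j(x)=x_j$, be the coordinate projections. Let $\{T_j\}$ be a countable family of non-empty compact subsets of $X$. Then there is a homeomorphism $g$ of $X$ onto $X$ such that every $g(T_j)$ is infinitely deficient, i.e. for each $j$ there is an infinite set $\beta_j$ of indices such that $\pi_l(g(T_j))$ consists of a single element for every $l\in\beta_j$. -/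

import Mathlib

open scoped ZeroAtInfty

/-- `E` is deficient in a direction with projection `p` if `p(E)` consists of a single element. -/
def DeficientInDirection {X K : Type*} (p : X → K) (E : Set X) : Prop :=
  ∃ c : K, p '' E = {c}

/-- For a space `X` with coordinate projections `π j : X → K`, a subset `E` of `X` is infinitely
deficient if there is an infinite set `β` of indices such that `π j (E)` is a singleton for every
`j ∈ β`. -/
def InfinitelyDeficient {X K J : Type*} (π : J → X → K) (E : Set X) : Prop :=
  ∃ β : Set J, β.Infinite ∧ ∀ j ∈ β, DeficientInDirection (π j) E

/-- The product `K^{ω₀}`; as a function space it carries the Tychonoff topology. -/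
abbrev SSpace (K : Type*) : Type _ := ℕ → K

/-- The Banach space `c₀` of sequences in `K` tending to zero, with the supremum norm: the
(continuous) functions on the discrete space `ℕ` that vanish at infinity. -/
abbrev CZero (K : Type*) [NormedField K] : Type _ := C₀(ℕ, K)

open Filter Topology

/-! Both spaces are complete groups with a neighbourhood basis of decreasing subgroups `U n`. Each
point is a series of digits, the `n`-th a chosen representative of a class of `U n` modulo `U (n +
1)`. The digits below level `n` determine the class modulo `U n` and conversely, so permuting digits
level by level is a homeomorphism (`IsDigitSelector.exists_homeomorph`).

A compact set uses finitely many digits per level, while infinitely many representatives at each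
level can be taken to vanish on one infinite index set `B`. At level `n` an involution moves the
digits of the compact sets numbered at most `n` among those. A given set then has only finitely many
uncontrolled levels, each with finitely many finitely supported digits, so its image vanishes at all
but finitely many indices of `B`. -/

/-- A finite subset of `R` can be moved into a given infinite subset of `R` by an involution
preserving `R`. -/
theorem exists_involutive_mapsTo {X : Type*} {R E W : Set X} (hE : E.Infinite) (hER : E ⊆ R)
    (hW : W.Finite) (hWR : W ⊆ R) :
    ∃ φ : X → X, Function.Involutive φ ∧ Set.MapsTo φ R R ∧ Set.MapsTo φ W E := by
  classical
  -- Taking `W'` disjoint from `W` makes the swap of the two sets, fixing everything else, an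
  -- involution.
  obtain ⟨W', hW'E, hcard⟩ := (hE.sdiff hW).exists_subset_card_eq hW.toFinset.card
  have e : hW.toFinset ≃ W' := Finset.equivOfCardEq hcard.symm
  have hdisj : ∀ x ∈ W', x ∉ hW.toFinset := fun x hx h =>
    (hW'E (by exact_mod_cast hx)).2 (hW.mem_toFinset.1 h)
  have hmem : ∀ y : W', (y : X) ∈ E := fun y => (hW'E (by exact_mod_cast y.2)).1
  have hmem' : ∀ y : hW.toFinset, (y : X) ∈ R := fun y => hWR (hW.mem_toFinset.1 y.2)
  refine ⟨fun x => if h : x ∈ hW.toFinset then e ⟨x, h⟩ else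
    if h' : x ∈ W' then e.symm ⟨x, h'⟩ else x, fun x => ?_, fun x hx => ?_, fun x hx => ?_⟩
  · by_cases h : x ∈ hW.toFinset
    · have h1 := hdisj _ (e ⟨x, h⟩).2
      simp only [dif_pos h, dif_neg h1, dif_pos (e ⟨x, h⟩).2, Subtype.coe_eta,
        Equiv.symm_apply_apply]
    · by_cases h' : x ∈ W'
      · simp only [dif_neg h, dif_pos h', dif_pos (e.symm ⟨x, h'⟩).2, Subtype.coe_eta,
          Equiv.apply_symm_apply]
      · simp only [dif_neg h, dif_neg h']
  · dsimp only
    split_ifs with h h'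
    · exact hER (hmem _)
    · exact hmem' _
    · exact hx
  · have h : x ∈ hW.toFinset := hW.mem_toFinset.2 hx
    simp only [dif_pos h]
    exact hmem _

/-! ### Digit expansions along a chain of subgroups -/

section Digits

variable {X : Type*} [AddCommGroup X]

/-- The remainder of `x` after subtracting its first `n` digits, where `ρ n` selects the digit at
level `n`. -/
def digitRem (ρ : ℕ → X → X) (x : X) : ℕ → X
  | 0 => x
  | n + 1 => digitRem ρ x n - ρ n (digitRem ρ x n)

/-- The `n`-th digit of `x` with respect to the selectors `ρ`. -/
def digit (ρ : ℕ → X → X) (n : ℕ) (x : X) : X := ρ n (digitRem ρ x n)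

theorem digitRem_eq_sub_sum (ρ : ℕ → X → X) (x : X) (n : ℕ) :
    digitRem ρ x n = x - ∑ k ∈ Finset.range n, digit ρ k x := by
  induction n with
  | zero => simp [digitRem]
  | succ n ih =>
    rw [Finset.sum_range_succ, ← sub_sub, ← ih]
    rfl

/-- `ρ` selects a representative in `U n` of each class of `U n` modulo `U (n + 1)`. -/
structure IsDigitSelector (U : ℕ → AddSubgroup X) (ρ : ℕ → X → X) : Prop where
  sub_mem : ∀ n, ∀ x ∈ U n, x - ρ n x ∈ U (n + 1)
  congr : ∀ n, ∀ x y, x - y ∈ U (n + 1) → ρ n x = ρ n y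

namespace IsDigitSelector

variable {U : ℕ → AddSubgroup X} {ρ : ℕ → X → X} (hρ : IsDigitSelector U ρ)
include hρ

theorem digitRem_mem (hU0 : U 0 = ⊤) (x : X) (n : ℕ) : digitRem ρ x n ∈ U n := by
  induction n with
  | zero => simp [hU0]
  | succ n ih => exact hρ.sub_mem n _ ih

theorem apply_mem (hU : Antitone U) {n : ℕ} {x : X} (hx : x ∈ U n) : ρ n x ∈ U n := by
  have h := (U n).sub_mem hx (hU n.le_succ (hρ.sub_mem n x hx))
  simpa using h

theorem apply_apply {n : ℕ} {x : X} (hx : x ∈ U n) : ρ n (ρ n x) = ρ n x :=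
  (hρ.congr n _ _ (hρ.sub_mem n x hx)).symm

/-- A selector sees only classes, so congruent points have the same digits subtracted and keep their
difference. -/
theorem digitRem_sub_digitRem (hU : Antitone U) {x y : X} {n : ℕ} (h : x - y ∈ U n) {k : ℕ}
    (hk : k ≤ n) : digitRem ρ x k - digitRem ρ y k = x - y := by
  induction k with
  | zero => rfl
  | succ k ih =>
    have h1 := ih (by omega)
    have h2 : ρ k (digitRem ρ x k) = ρ k (digitRem ρ y k) :=
      hρ.congr k _ _ (h1 ▸ hU hk h)
    simp only [digitRem, h2, sub_sub_sub_cancel_right, h1]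

theorem digit_congr (hU : Antitone U) {x y : X} {n : ℕ} (h : x - y ∈ U n) {k : ℕ} (hk : k < n) :
    digit ρ k x = digit ρ k y :=
  hρ.congr k _ _ (hρ.digitRem_sub_digitRem hU h hk.le ▸ hU hk h)

/-- A convergent series of digits has the prescribed digits. -/
theorem digit_eq {s : ℕ → X} (hs : ∀ n, s n ∈ ρ n '' U n) {x : X}
    (hx : ∀ n, x - ∑ k ∈ Finset.range n, s k ∈ U n) (n : ℕ) : digit ρ n x = s n := by
  have key : ∀ n, digitRem ρ x n = x - ∑ k ∈ Finset.range n, s k → digit ρ n x = s n := by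
    intro n hn
    obtain ⟨y, hy, hys⟩ := hs n
    rw [digit, hn, ← hys, ← hρ.apply_apply hy, hys]
    refine hρ.congr n _ _ ?_
    rw [sub_sub, ← Finset.sum_range_succ]
    exact hx (n + 1)
  refine key n ?_
  induction n with
  | zero => simp [digitRem]
  | succ n ih =>
    rw [Finset.sum_range_succ, ← sub_sub, ← ih, ← key n ih]
    rfl

end IsDigitSelector

end Digits

/-- In a complete group, a series with terms in a neighbourhood basis of decreasing subgroups
converges. -/
theorem exists_sub_sum_mem {X : Type*} [AddCommGroup X] [UniformSpace X] [IsUniformAddGroup X]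
    [CompleteSpace X] {U : ℕ → AddSubgroup X} (hU : Antitone U)
    (hb : (𝓝 (0 : X)).HasBasis (fun _ : ℕ => True) fun n => (U n : Set X)) {s : ℕ → X}
    (hs : ∀ n, s n ∈ U n) : ∃ x, ∀ n, x - ∑ k ∈ Finset.range n, s k ∈ U n := by
  have hsub : ∀ n m, n ≤ m →
      ∑ k ∈ Finset.range m, s k - ∑ k ∈ Finset.range n, s k ∈ U n := by
    intro n m hnm
    induction m, hnm using Nat.le_induction with
    | base => simp
    | succ m hm ih =>
      rw [Finset.sum_range_succ, add_sub_right_comm]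
      exact (U n).add_mem ih (hU hm (hs m))
  have hc : CauchySeq fun n => ∑ k ∈ Finset.range n, s k := by
    rw [hb.uniformity_of_nhds_zero.cauchySeq_iff]
    refine fun n _ => ⟨n, fun a ha b hb => ?_⟩
    have := (U n).sub_mem (hsub n b hb) (hsub n a ha)
    simpa using this
  obtain ⟨x, hx⟩ := cauchySeq_tendsto_of_complete hc
  refine ⟨x, fun n => ?_⟩
  have hcl : IsClosed (U n : Set X) :=
    AddSubgroup.isClosed_of_isOpen _ ((U n).isOpen_of_mem_nhds (g := 0) (hb.mem_of_mem trivial))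
  exact hcl.mem_of_tendsto (hx.sub_const _) (eventually_atTop.2 ⟨n, fun m hm => hsub n m hm⟩)

/-- Applying involutions to the digits is a self-homeomorphism. -/
theorem IsDigitSelector.exists_homeomorph {X : Type*} [AddCommGroup X] [UniformSpace X]
    [IsUniformAddGroup X] [CompleteSpace X] [T2Space X] {U : ℕ → AddSubgroup X} {ρ : ℕ → X → X}
    (hρ : IsDigitSelector U ρ) (hU : Antitone U) (hU0 : U 0 = ⊤)
    (hb : (𝓝 (0 : X)).HasBasis (fun _ : ℕ => True) fun n => (U n : Set X)) (φ : ℕ → X → X)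
    (hφ : ∀ n, Function.Involutive (φ n))
    (hφR : ∀ n, Set.MapsTo (φ n) (ρ n '' U n) (ρ n '' U n)) :
    ∃ g : X ≃ₜ X, ∀ x n, g x - ∑ k ∈ Finset.range n, φ k (digit ρ k x) ∈ U n := by
  have hdig : ∀ x n, digit ρ n x ∈ ρ n '' U n := fun x n =>
    ⟨_, hρ.digitRem_mem hU0 x n, rfl⟩
  have hlim : ∀ x, ∃ y, ∀ n, y - ∑ k ∈ Finset.range n, φ k (digit ρ k x) ∈ U n := by
    refine fun x => exists_sub_sum_mem hU hb fun n => ?_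
    obtain ⟨y, hy, h⟩ := hφR n (hdig x n)
    exact h ▸ hρ.apply_mem hU hy
  choose g hg using hlim
  have hgd : ∀ x n, digit ρ n (g x) = φ n (digit ρ n x) := fun x n =>
    hρ.digit_eq (s := fun n => φ n (digit ρ n x)) (fun n => hφR n (hdig x n)) (hg x) n
  -- The digits of `g (g x)` are those of `x`, and digits determine a point because the `U n` shrink
  -- to zero.
  have hinv : Function.Involutive g := by
    intro x
    by_contra hne
    have hV : {y : X | y ≠ g (g x) - x} ∈ 𝓝 (0 : X) :=
      isOpen_ne.mem_nhds (Ne.symm (sub_ne_zero.2 hne))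
    obtain ⟨n, -, hn⟩ := hb.mem_iff.1 hV
    refine hn (a := g (g x) - x) ?_ rfl
    have h1 := hg (g x) n
    simp only [hgd, hφ _ _] at h1
    have h2 := hρ.digitRem_mem hU0 x n
    rw [digitRem_eq_sub_sum] at h2
    have := (U n).sub_mem h1 h2
    simpa using this
  have hcont : Continuous g := by
    refine continuous_iff_continuousAt.2 fun x => ?_
    have hbx : ∀ z : X, (𝓝 z).HasBasis (fun _ : ℕ => True) fun n => {y | y - z ∈ U n} := by
      intro z
      rw [← nhds_translation_sub z]
      exact hb.comap _
    refine ((hbx x).tendsto_iff (hbx (g x))).2 fun n _ => ⟨n, trivial, fun y hy => ?_⟩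
    have h1 := (U n).sub_mem (hg y n) (hg x n)
    rw [Finset.sum_congr rfl fun k hk => by
      rw [hρ.digit_congr hU hy (Finset.mem_range.1 hk)]] at h1
    simpa using h1
  exact ⟨⟨hinv.toPerm, hcont, hcont⟩, hg⟩

/-- Only finitely many digits occur at each level in a compact set. -/
theorem IsDigitSelector.finite_digit_image {X : Type*} [AddCommGroup X] [TopologicalSpace X]
    [IsTopologicalAddGroup X] {U : ℕ → AddSubgroup X} {ρ : ℕ → X → X}
    (hρ : IsDigitSelector U ρ) (hU : Antitone U) (hn : ∀ n, (U n : Set X) ∈ 𝓝 0) {T : Set X}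
    (hT : IsCompact T) (n : ℕ) : (digit ρ n '' T).Finite := by
  obtain ⟨t, -, ht⟩ := hT.elim_nhds_subcover (fun x => {y | y - x ∈ U (n + 1)}) fun x _ => by
    rw [← nhds_translation_sub x]
    exact preimage_mem_comap (hn (n + 1))
  refine (t.finite_toSet.image (digit ρ n)).subset ?_
  rintro _ ⟨y, hy, rfl⟩
  obtain ⟨x, hx, hyx⟩ := Set.mem_iUnion₂.1 (ht hy)
  exact ⟨x, hx, (hρ.digit_congr hU hyx n.lt_succ_self).symm⟩

/-! ### The general deficiency theorem -/

/-- Let `X` be a complete group with continuous coordinates `p j` and a neighbourhood basis `U n` of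
subgroups such that every element of `U n` is congruent modulo `U (n + 1)` to a finitely supported
one, and infinitely many classes contain finitely supported elements supported off an infinite set
`B`. Then countably many compact sets can be made infinitely deficient simultaneously. -/
theorem exists_homeomorph_infinitelyDeficient {X K ι : Type*} [AddCommGroup X] [UniformSpace X]
    [IsUniformAddGroup X] [CompleteSpace X] [T2Space X] [AddCommGroup K] [TopologicalSpace K]
    [T2Space K] [Countable ι] {U : ℕ → AddSubgroup X} (hU : Antitone U) (hU0 : U 0 = ⊤)
    (hb : (𝓝 (0 : X)).HasBasis (fun _ : ℕ => True) fun n => (U n : Set X))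
    (p : ℕ → X →+ K) (hp : ∀ j, Continuous (p j)) {B : Set ℕ} (hB : B.Infinite)
    (hfin : ∀ n, ∀ x ∈ U n, ∃ s, {j | p j s ≠ 0}.Finite ∧ x - s ∈ U (n + 1))
    (hinf : ∀ n, ∃ v : ℕ → X, (∀ m, v m ∈ U n ∧ {j | p j (v m) ≠ 0}.Finite ∧
      ∀ j ∈ B, p j (v m) = 0) ∧ ∀ m m', m ≠ m' → v m - v m' ∉ U (n + 1))
    (T : ι → Set X) (hT : ∀ i, IsCompact (T i)) :
    ∃ g : X ≃ₜ X, ∀ i, (T i).Nonempty →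
      InfinitelyDeficient (fun (j : ℕ) (x : X) => p j x) (g '' T i) := by
  classical
  choose v hv hvne using hinf
  -- Representatives are chosen per class, with priority to the `v n m`; classes missing `U n` get
  -- the junk value 0.
  have hsel : ∀ n, ∀ q : X ⧸ U (n + 1), ∃ s : X,
      (∀ m, (v n m : X ⧸ U (n + 1)) = q → s = v n m) ∧
      ∀ x ∈ U n, (x : X ⧸ U (n + 1)) = q → {j | p j s ≠ 0}.Finite ∧ x - s ∈ U (n + 1) := by
    intro n q
    by_cases h : ∃ m, (v n m : X ⧸ U (n + 1)) = q
    · obtain ⟨m, rfl⟩ := h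
      refine ⟨v n m, fun m' h' => ?_, fun x _ hxq => ⟨(hv n m).2.1, ?_⟩⟩
      · by_contra hne
        refine hvne n m m' (fun h => hne (by rw [h])) ?_
        rw [QuotientAddGroup.eq, neg_add_eq_sub] at h'
        exact h'
      · rw [eq_comm, QuotientAddGroup.eq, neg_add_eq_sub] at hxq
        exact hxq
    · by_cases h2 : ∃ x ∈ U n, (x : X ⧸ U (n + 1)) = q
      · obtain ⟨x, hx, rfl⟩ := h2
        obtain ⟨s, hs, hxs⟩ := hfin n x hx
        refine ⟨s, fun m hm => (h ⟨m, hm⟩).elim, fun y _ hy => ⟨hs, ?_⟩⟩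
        rw [eq_comm, QuotientAddGroup.eq, neg_add_eq_sub] at hy
        simpa using (U (n + 1)).add_mem hy hxs
      · exact ⟨0, fun m hm => (h ⟨m, hm⟩).elim, fun x hx hxq => (h2 ⟨x, hx, hxq⟩).elim⟩
  choose σ hσv hσ using hsel
  set ρ : ℕ → X → X := fun n x => σ n x with hρdef
  have hρ : IsDigitSelector U ρ :=
    ⟨fun n x hx => (hσ n x x hx rfl).2, fun n x y h => by
      have : (x : X ⧸ U (n + 1)) = y := by
        rw [eq_comm, QuotientAddGroup.eq, neg_add_eq_sub]
        exact h
      simp only [hρdef, this]⟩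
  have hER : ∀ n, Set.range (v n) ⊆ ρ n '' U n := by
    rintro n _ ⟨m, rfl⟩
    exact ⟨v n m, (hv n m).1, hσv n _ m rfl⟩
  have hE : ∀ n, (Set.range (v n)).Infinite := fun n =>
    Set.infinite_range_of_injective fun m m' h => by
      by_contra hne
      exact hvne n m m' hne (by simp [h])
  obtain ⟨e, he⟩ := exists_injective_nat ι
  have hTd : ∀ i n, (digit ρ n '' T i).Finite := fun i n =>
    hρ.finite_digit_image hU (fun n => hb.mem_of_mem trivial) (hT i) n
  have hdig : ∀ x n, digit ρ n x ∈ ρ n '' U n := fun x n =>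
    ⟨_, hρ.digitRem_mem hU0 x n, rfl⟩
  have hW : ∀ n, (⋃ i ∈ {i | e i ≤ n}, digit ρ n '' T i).Finite := fun n =>
    Set.Finite.biUnion ((Set.finite_Iic n).preimage he.injOn) fun i _ => hTd i n
  have hWR : ∀ n, (⋃ i ∈ {i | e i ≤ n}, digit ρ n '' T i) ⊆ ρ n '' U n := by
    intro n
    refine Set.iUnion₂_subset fun i _ => ?_
    rintro _ ⟨x, -, rfl⟩
    exact hdig x n
  choose φ hφ hφR hφE using fun n => exists_involutive_mapsTo (hE n) (hER n) (hW n) (hWR n)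
  obtain ⟨g, hg⟩ := hρ.exists_homeomorph hU hU0 hb φ hφ hφR
  refine ⟨g, fun i hi => ?_⟩
  -- Indices where digits from the levels below `e i` may be nonzero; they are discarded from `B`.
  have hbad : (⋃ n ∈ Set.Iio (e i), ⋃ s ∈ φ n '' (digit ρ n '' T i), {j | p j s ≠ 0}).Finite := by
    refine (Set.finite_Iio _).biUnion fun n _ => ((hTd i n).image _).biUnion ?_
    rintro _ ⟨_, ⟨x, -, rfl⟩, rfl⟩
    obtain ⟨y, hy, hys⟩ := hφR n (hdig x n)
    rw [← hys]
    exact (hσ n y y hy rfl).1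
  refine ⟨_, hB.sdiff hbad, fun j hj => ⟨0, ?_⟩⟩
  refine ((hi.image g).image _).subset_singleton_iff.1 ?_
  rintro _ ⟨_, ⟨x, hx, rfl⟩, rfl⟩
  have hterm : ∀ n, p j (φ n (digit ρ n x)) = 0 := by
    intro n
    by_cases hn : e i ≤ n
    · obtain ⟨m, hm⟩ := hφE n (Set.mem_biUnion (show i ∈ {i | e i ≤ n} from hn)
        (Set.mem_image_of_mem _ hx))
      rw [← hm]
      exact (hv n m).2.2 j hj.1
    · by_contra hne
      exact hj.2 (Set.mem_biUnion (show n ∈ Set.Iio (e i) from not_le.1 hn)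
        (Set.mem_biUnion (Set.mem_image_of_mem _ (Set.mem_image_of_mem _ hx)) hne))
  have hlim : Tendsto (fun n => g x - ∑ k ∈ Finset.range n, φ k (digit ρ k x)) atTop (𝓝 0) := by
    refine (atTop_basis.tendsto_iff hb).2 fun n _ => ⟨n, trivial, fun m hm => ?_⟩
    exact hU hm (hg x m)
  have h := ((hp j).tendsto 0).comp hlim
  simp only [Function.comp_def, map_sub, map_sum, hterm, Finset.sum_const_zero, sub_zero,
    map_zero] at h
  exact tendsto_nhds_unique tendsto_const_nhds h

/-! ### Coordinate balls and the product space -/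

section Coordinates

variable {X K : Type*} [AddCommGroup X] [NormedField K] [IsUltrametricDist K]

/-- The elements of `X` whose coordinates with index in `C` have norm at most `r`. -/
def coordBall (p : ℕ → X →+ K) (C : Set ℕ) (r : ℝ) (hr : 0 ≤ r) : AddSubgroup X where
  carrier := {x | ∀ j ∈ C, ‖p j x‖ ≤ r}
  zero_mem' := by simp [hr]
  add_mem' := fun hx hy j hj => by
    rw [map_add]
    exact (IsUltrametricDist.norm_add_le_max _ _).trans (max_le (hx j hj) (hy j hj))
  neg_mem' := fun hx j hj => by simpa using hx j hj

theorem mem_coordBall {p : ℕ → X →+ K} {C : Set ℕ} {r : ℝ} {hr : 0 ≤ r} {x : X} :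
    x ∈ coordBall p C r hr ↔ ∀ j ∈ C, ‖p j x‖ ≤ r := Iff.rfl

theorem antitone_coordBall (p : ℕ → X →+ K) {C : ℕ → Set ℕ} (hC : Monotone C) {r : ℝ} (hr : 0 ≤ r)
    (hr1 : r ≤ 1) : Antitone fun n => coordBall p (C n) (r ^ n) (pow_nonneg hr n) :=
  fun _ _ hmn _ hx j hj => (hx j (hC hmn hj)).trans (pow_le_pow_of_le_one hr hr1 hmn)

end Coordinates

theorem infinite_odd : {j : ℕ | Odd j}.Infinite :=
  Set.infinite_of_injective_forall_mem (f := fun k : ℕ => 2 * k + 1)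
    (fun a b h => by simpa using h) fun k => odd_two_mul_add_one k

/-- The product case. -/
theorem exists_homeomorph_pi (K : Type*) [NontriviallyNormedField K] [IsUltrametricDist K]
    [CompleteSpace K] {ι : Type*} [Countable ι] (T : ι → Set (SSpace K))
    (hT : ∀ i, IsCompact (T i)) :
    ∃ g : SSpace K ≃ₜ SSpace K, ∀ i, (T i).Nonempty →
      InfinitelyDeficient (fun (j : ℕ) (x : SSpace K) => x j) (g '' T i) := by
  classical
  obtain ⟨π, hπ0, hπ1⟩ := NormedField.exists_norm_lt_one K
  -- Coordinate `2 * n` is free in `U n` but bounded in `U (n + 1)`, so the unbounded powers of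
  -- `π⁻¹` placed there give infinitely many classes, supported off the odd indices.
  have hC : Monotone fun n : ℕ => {j : ℕ | j < 2 * n} := fun m n hmn j hj =>
    lt_of_lt_of_le (show j < 2 * m from hj) (Nat.mul_le_mul_left 2 hmn)
  refine exists_homeomorph_infinitelyDeficient
    (antitone_coordBall (Pi.evalAddMonoidHom fun _ : ℕ => K) hC hπ0.le hπ1.le) ?_ ?_
    (Pi.evalAddMonoidHom fun _ : ℕ => K) (fun j => continuous_apply j) infinite_odd ?_ ?_ T hT
  · ext x
    simp [mem_coordBall]
  · refine ⟨fun V => ⟨fun hV => ?_, fun ⟨n, _, hn⟩ => mem_of_superset ?_ hn⟩⟩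
    · rw [nhds_pi, Filter.mem_pi] at hV
      obtain ⟨I, hI, t, ht, htV⟩ := hV
      have h1 : ∀ j, ∀ᶠ n in atTop, Metric.closedBall (0 : K) (‖π‖ ^ n) ⊆ t j := by
        intro j
        obtain ⟨ε, hε, hεt⟩ := Metric.mem_nhds_iff.1 (ht j)
        filter_upwards [(tendsto_pow_atTop_nhds_zero_of_lt_one hπ0.le hπ1).eventually_lt_const hε]
          with n hn
        exact (Metric.closedBall_subset_ball hn).trans hεt
      have h2 : ∀ j, ∀ᶠ n in atTop, j < 2 * n := fun j => by
        filter_upwards [eventually_gt_atTop j] with n hn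
        omega
      obtain ⟨n, hn⟩ := ((hI.eventually_all (l := atTop)).2 fun j _ => (h1 j).and (h2 j)).exists
      refine ⟨n, trivial, fun x hx => htV fun j hj => (hn j hj).1 ?_⟩
      rw [mem_closedBall_zero_iff]
      exact hx j (hn j hj).2
    · refine mem_of_superset (set_pi_mem_nhds (Set.finite_lt_nat (2 * n)) (x := (0 : ℕ → K))
        (s := fun _ => Metric.closedBall 0 (‖π‖ ^ n)) fun j _ =>
          Metric.closedBall_mem_nhds _ (pow_pos hπ0 n)) fun x hx j hj => ?_
      exact mem_closedBall_zero_iff.1 (hx j hj)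
  · refine fun n x _ => ⟨fun j => if j < 2 * (n + 1) then x j else 0, ?_, fun j hj => ?_⟩
    · refine (Set.finite_lt_nat (2 * (n + 1))).subset fun j hj => ?_
      by_contra h
      exact hj (if_neg h)
    · have hj' : j < 2 * (n + 1) := hj
      simp [hj']
  · refine fun n => ⟨fun m => Pi.single (2 * n) (π⁻¹ ^ m), fun m => ⟨fun j hj => ?_, ?_, ?_⟩,
      fun m m' hne h => ?_⟩
    · have hj' : j ≠ 2 * n := ne_of_lt hj
      simp [hj', pow_nonneg]
    · refine (Set.finite_singleton (2 * n)).subset fun j hj => ?_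
      by_contra h
      exact hj (Pi.single_eq_of_ne h _)
    · intro j hj
      refine Pi.single_eq_of_ne (fun h => ?_) _
      rw [h] at hj
      exact Nat.not_odd_iff_even.2 (even_two_mul n) hj
    · have h1 : ‖π⁻¹ ^ m - π⁻¹ ^ m'‖ ≤ ‖π‖ ^ (n + 1) := by
        simpa using h (2 * n) (show 2 * n < 2 * (n + 1) by omega)
      -- Unequal norms force the difference to have the larger norm, which is at least 1.
      have h2 : ‖π⁻¹ ^ m‖ ≠ ‖π⁻¹ ^ m'‖ := by
        rw [norm_pow, norm_pow, norm_inv]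
        exact fun h => hne (pow_right_injective₀ (inv_pos.2 hπ0) (one_lt_inv₀ hπ0 |>.2 hπ1).ne' h)
      rw [sub_eq_add_neg, IsUltrametricDist.norm_add_eq_max_of_norm_ne_norm (by rwa [norm_neg])]
        at h1
      have h3 : 1 ≤ ‖π⁻¹ ^ m‖ := by
        rw [norm_pow, norm_inv]
        exact one_le_pow₀ (one_lt_inv₀ hπ0 |>.2 hπ1).le
      exact absurd (h3.trans ((le_max_left _ _).trans h1))
        (not_le.2 (pow_lt_one₀ hπ0.le hπ1 n.succ_ne_zero))

/-! ### The Banach space `c₀` -/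

namespace CZero

variable {K : Type*} [NormedField K]

/-- The coordinate `x ↦ x j` on `c₀`. -/
def coord (j : ℕ) : CZero K →+ K where
  toFun x := x j
  map_zero' := rfl
  map_add' _ _ := rfl

/-- A finitely supported sequence as an element of `c₀`. -/
def ofFinite (f : ℕ → K) (hf : {j | f j ≠ 0}.Finite) : CZero K where
  toFun := f
  continuous_toFun := continuous_of_discreteTopology
  zero_at_infty' := by
    refine tendsto_const_nhds.congr' ?_
    rw [cocompact_eq_cofinite]
    filter_upwards [hf.compl_mem_cofinite] with j hj
    exact (not_not.1 hj).symm


theorem norm_le_iff {x : CZero K} {r : ℝ} (hr : 0 ≤ r) : ‖x‖ ≤ r ↔ ∀ j, ‖x j‖ ≤ r := by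
  rw [← ZeroAtInftyContinuousMap.norm_toBCF_eq_norm, BoundedContinuousFunction.norm_le hr]
  rfl

theorem continuous_coord (j : ℕ) : Continuous (coord j : CZero K →+ K) :=
  AddMonoidHomClass.continuous_of_bound _ 1 fun x => by
    rw [one_mul]
    exact (norm_le_iff (norm_nonneg x)).1 le_rfl j

theorem finite_lt_norm (x : CZero K) {r : ℝ} (hr : 0 < r) : {j | r < ‖x j‖}.Finite := by
  have h := (zero_at_infty x).norm
  rw [cocompact_eq_cofinite, norm_zero] at h
  refine (h.eventually_lt_const hr).subset fun j hj => ?_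
  exact fun h => lt_asymm h (show r < ‖x j‖ from hj)

end CZero

/-- The Banach space case. -/
theorem exists_homeomorph_cZero (K : Type*) [NontriviallyNormedField K] [IsUltrametricDist K]
    [CompleteSpace K] {ι : Type*} [Countable ι] (T : ι → Set (CZero K))
    (hT : ∀ i, IsCompact (T i)) :
    ∃ g : CZero K ≃ₜ CZero K, ∀ i, (T i).Nonempty →
      InfinitelyDeficient (fun (j : ℕ) (x : CZero K) => x j) (g '' T i) := by
  classical
  obtain ⟨π, hπ0, hπ1⟩ := NormedField.exists_norm_lt_one K
  -- The index set is empty for `n = 0`, giving `U 0 = ⊤`, and everything afterwards.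
  have hC : Monotone fun n : ℕ => {_j : ℕ | n ≠ 0} := fun m n hmn j hj =>
    show n ≠ 0 from fun h => hj (by omega)
  have hball : ∀ {n : ℕ} {x : CZero K}, n ≠ 0 → (x ∈ coordBall (CZero.coord (K := K))
      {_j : ℕ | n ≠ 0} (‖π‖ ^ n) (pow_nonneg hπ0.le n) ↔ ‖x‖ ≤ ‖π‖ ^ n) := fun {n x} hn => by
    rw [CZero.norm_le_iff (pow_nonneg hπ0.le n)]
    exact ⟨fun h j => h j hn, fun h j _ => h j⟩
  refine exists_homeomorph_infinitelyDeficient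
    (antitone_coordBall (CZero.coord (K := K)) hC hπ0.le hπ1.le) ?_ ?_
    (CZero.coord (K := K)) CZero.continuous_coord infinite_odd ?_ ?_ T hT
  · ext x
    simp [mem_coordBall]
  · refine ⟨fun V => ⟨fun hV => ?_, fun ⟨n, _, hn⟩ => mem_of_superset ?_ hn⟩⟩
    · obtain ⟨ε, hε, hεV⟩ := Metric.mem_nhds_iff.1 hV
      obtain ⟨n, hn, hn0⟩ := (((tendsto_pow_atTop_nhds_zero_of_lt_one hπ0.le hπ1).eventually_lt_const
        hε).and (eventually_ne_atTop 0)).exists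
      refine ⟨n, trivial, fun x hx => hεV ?_⟩
      rw [mem_ball_zero_iff]
      exact ((hball hn0).1 hx).trans_lt hn
    · refine mem_of_superset (Metric.closedBall_mem_nhds (0 : CZero K) (pow_pos hπ0 n))
        fun x hx j _ => ?_
      exact (CZero.norm_le_iff (pow_nonneg hπ0.le n)).1 (mem_closedBall_zero_iff.1 hx) j
  · intro n x _
    -- Dropping the coordinates of norm at most `‖π‖ ^ (n + 1)` leaves a finitely supported element
    -- of the same class.
    have hf := CZero.finite_lt_norm x (pow_pos hπ0 (n + 1))
    have hs : {j | (if ‖π‖ ^ (n + 1) < ‖x j‖ then x j else 0) ≠ 0}.Finite :=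
      hf.subset fun j hj => by
        by_contra h
        exact hj (if_neg h)
    refine ⟨CZero.ofFinite _ hs, hs, fun j _ => ?_⟩
    change ‖x j - (if ‖π‖ ^ (n + 1) < ‖x j‖ then x j else 0)‖ ≤ _
    split_ifs with h
    · simp
    · simpa using h
  · intro n
    -- The residue field may be finite, so the infinitely many classes come from placing `π ^ n` at
    -- different even indices.
    have hs : ∀ m, {j | (Pi.single (2 * m) (π ^ n) : ℕ → K) j ≠ 0}.Finite := fun m =>
      (Set.finite_singleton (2 * m)).subset fun j hj => by
        by_contra h
        exact hj (Pi.single_eq_of_ne h _)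
    refine ⟨fun m => CZero.ofFinite _ (hs m), fun m => ⟨fun j _ => ?_, hs m, fun j hj => ?_⟩,
      fun m m' hne h => ?_⟩
    · change ‖(Pi.single (2 * m) (π ^ n) : ℕ → K) j‖ ≤ _
      by_cases hj : j = 2 * m
      · subst hj
        simp
      · simp [hj, pow_nonneg]
    · refine Pi.single_eq_of_ne (fun h => ?_) _
      rw [h] at hj
      exact Nat.not_odd_iff_even.2 (even_two_mul m) hj
    · have h1 : ‖(Pi.single (2 * m) (π ^ n) : ℕ → K) (2 * m) -
          (Pi.single (2 * m') (π ^ n) : ℕ → K) (2 * m)‖ ≤ ‖π‖ ^ (n + 1) :=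
        h (2 * m) n.succ_ne_zero
      rw [Pi.single_eq_same, Pi.single_eq_of_ne (by omega), sub_zero, norm_pow] at h1
      exact absurd h1 (not_le.2 (pow_lt_pow_right_of_lt_one₀ hπ0 hπ1 n.lt_succ_self))

theorem theorem21 (K : Type*) [NontriviallyNormedField K] [IsUltrametricDist K] [CompleteSpace K]
    {ι : Type*} [Countable ι] :
    (∀ T : ι → Set (SSpace K), (∀ i, IsCompact (T i)) →
      ∃ g : SSpace K ≃ₜ SSpace K, ∀ i, (T i).Nonempty →
        InfinitelyDeficient (fun (j : ℕ) (x : SSpace K) => x j) (g '' T i)) ∧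
    (∀ T : ι → Set (CZero K), (∀ i, IsCompact (T i)) →
      ∃ g : CZero K ≃ₜ CZero K, ∀ i, (T i).Nonempty →
        InfinitelyDeficient (fun (j : ℕ) (x : CZero K) => x j) (g '' T i)) :=
  ⟨exists_homeomorph_pi K, exists_homeomorph_cZero K⟩
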